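/- Let $H$ be a separable complex Hilbert space and let $\alpha$ be a $*$-automorphism of $B(H)$. Then there is a unitary $U\in B(H)$ with $\alpha(x)=UxU^*$ for all $x\in B(H)$. For every such $U$ and every Følner sequence $(F_n)$ of finite subsets of $\mathbb Z$, let $P_c$ be the orthogonal projection onto the compact part $H_c$ of $U$, i.e. the closed linear span of the eigenvectors of $U$, and let $P_{wm}$ be the orthogonal projection onto the weakly mixing part $$H_{wm}=\Big\{\xi\in H:\ \lim_{n\to\infty}\frac1{|F_n|}\sum_{k\in F_n}|\langle U^k\xi,\eta\rangle|^2=0\ \text{ for all }\eta\in H\Big\},$$ which is a closed subspace. Then $P_c+P_{wm}=1$ and: 1. if $P_c\neq 0$, there is a normal state $\varphi_c$ on $B(H)$ with $\varphi_c\circ\alpha=\varphi_c$ and support $s(\varphi_c)=P_c$; 2. there is a weakly wandering operator $x_{wm}\in B(H)$ with support $s(x_{wm})=P_{wm}$, that is, $x_{wm}\ge 0$ and $$\lim_{n\to\infty}\Big\|\frac1{|F_n|}\sum_{k\in F_n}\alpha^k(x_{wm})\Big\|=0 .$$ Here the support of a normal state $\varphi$ is $1-q$, where $q$ is the least upper bound,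 among projections, of the projections $e$ with $\varphi(e)=0$, and the support of a positive operator $x$ is the least projection $p$ with $px=x$. -/

import Mathlib

noncomputable section

namespace NeveuBH

open Filter Topology MeasureTheory
open scoped InnerProductSpace ComplexOrder

/-! ### Normal states on `B(H)` and supports -/

section States

variable {H : Type*} [NormedAddCommGroup H] [InnerProductSpace ℂ H] [CompleteSpace H]

/-- The ultraweak (`σ`-weak, or `w`-) topology on `B(H)`: the coarsest topology that makes all
functionals `x ↦ ∑ₙ ⟪ηₙ, x ξₙ⟫` with `∑ ‖ξₙ‖² < ∞` and `∑ ‖ηₙ‖² < ∞` continuous. -/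
@[reducible] def ultraweakTopology (H : Type*) [NormedAddCommGroup H] [InnerProductSpace ℂ H] :
    TopologicalSpace (H →L[ℂ] H) :=
  ⨅ (ξ : ℕ → H) (η : ℕ → H) (_ : Summable fun n ↦ ‖ξ n‖ ^ 2) (_ : Summable fun n ↦ ‖η n‖ ^ 2),
    TopologicalSpace.induced (fun x : H →L[ℂ] H ↦ ∑' n, ⟪η n, x (ξ n)⟫_ℂ) inferInstance

/-- A normal state on `B(H)`: a positive, unital and ultraweakly continuous linear functional. -/
structure IsNormalState (φ : (H →L[ℂ] H) →ₗ[ℂ] ℂ) : Prop where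
  nonneg : ∀ x : H →L[ℂ] H, 0 ≤ φ (star x * x)
  map_one : φ 1 = 1
  normal : @Continuous _ _ (ultraweakTopology H) inferInstance φ

/-- `p` is the support of the functional `φ`: it is `1 - q`, where `q` is the least upper bound,
among projections, of all projections on which `φ` vanishes. -/
def IsFunctionalSupport (φ : (H →L[ℂ] H) →ₗ[ℂ] ℂ) (p : H →L[ℂ] H) : Prop :=
  ∃ q : {e : H →L[ℂ] H // IsStarProjection e},
    IsLUB {e : {e : H →L[ℂ] H // IsStarProjection e} | φ (e : H →L[ℂ] H) = 0} q ∧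
      p = 1 - (q : H →L[ℂ] H)

/-- `p` is the support of the operator `x`: the least projection with `p x = x`. -/
def IsOperatorSupport (x p : H →L[ℂ] H) : Prop :=
  IsLeast {e : H →L[ℂ] H | IsStarProjection e ∧ e * x = x} p

/-- The average `Aₙ(x) = |Fₙ|⁻¹ ∑_{k ∈ Fₙ} αᵏ(x)`. -/
def average (α : (H →L[ℂ] H) ≃⋆ₐ[ℂ] (H →L[ℂ] H)) (F : ℕ → Finset ℤ) (n : ℕ)
    (x : H →L[ℂ] H) : H →L[ℂ] H :=
  ((F n).card : ℂ)⁻¹ • ∑ k ∈ F n, (α ^ k) x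

/-- A weakly wandering operator: a positive operator whose averages tend to `0` in norm. -/
def IsWeaklyWandering (α : (H →L[ℂ] H) ≃⋆ₐ[ℂ] (H →L[ℂ] H)) (F : ℕ → Finset ℤ)
    (x : H →L[ℂ] H) : Prop :=
  x.IsPositive ∧ Tendsto (fun n ↦ ‖average α F n x‖) atTop (𝓝 0)

/-- A Følner sequence of finite subsets of `ℤ` (with respect to counting measure). -/
def IsFolnerSeq (F : ℕ → Finset ℤ) : Prop :=
  IsAddFoelner ℤ (Measure.count : Measure ℤ) atTop (fun n ↦ (F n : Set ℤ))

end States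

/-! ### The compact and the weakly mixing part of a unitary -/

section Parts

variable {H : Type*} [NormedAddCommGroup H] [InnerProductSpace ℂ H] [CompleteSpace H]

/-- The compact part of `U`: the closed linear span of the eigenvectors of `U`. -/
def compactPart (U : unitary (H →L[ℂ] H)) : Submodule ℂ H :=
  (⨆ μ : ℂ, Module.End.eigenspace ((U : H →L[ℂ] H) : H →ₗ[ℂ] H) μ).topologicalClosure

instance compactPart_complete (U : unitary (H →L[ℂ] H)) : CompleteSpace (compactPart U) :=
  (Submodule.isClosed_topologicalClosure _).completeSpace_coe

/-- The averages `|Fₙ|⁻¹ ∑_{k ∈ Fₙ} |⟪Uᵏ ξ, η⟫|²`. -/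
def correlation (U : unitary (H →L[ℂ] H)) (F : ℕ → Finset ℤ) (ξ η : H) (n : ℕ) : ℝ :=
  ((F n).card : ℝ)⁻¹ * ∑ k ∈ F n, ‖⟪((U ^ k : unitary (H →L[ℂ] H)) : H →L[ℂ] H) ξ, η⟫_ℂ‖ ^ 2

theorem correlation_nonneg (U : unitary (H →L[ℂ] H)) (F : ℕ → Finset ℤ) (ξ η : H) (n : ℕ) :
    0 ≤ correlation U F ξ η n := by
  unfold correlation; positivity

theorem correlation_add_le (U : unitary (H →L[ℂ] H)) (F : ℕ → Finset ℤ) (ξ ζ η : H) (n : ℕ) :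
    correlation U F (ξ + ζ) η n ≤ 2 * correlation U F ξ η n + 2 * correlation U F ζ η n := by
  unfold correlation
  have h : ∑ k ∈ F n, ‖⟪((U ^ k : unitary (H →L[ℂ] H)) : H →L[ℂ] H) (ξ + ζ), η⟫_ℂ‖ ^ 2 ≤
      2 * ∑ k ∈ F n, ‖⟪((U ^ k : unitary (H →L[ℂ] H)) : H →L[ℂ] H) ξ, η⟫_ℂ‖ ^ 2 +
      2 * ∑ k ∈ F n, ‖⟪((U ^ k : unitary (H →L[ℂ] H)) : H →L[ℂ] H) ζ, η⟫_ℂ‖ ^ 2 := by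
    rw [Finset.mul_sum, Finset.mul_sum, ← Finset.sum_add_distrib]
    refine Finset.sum_le_sum fun k _ ↦ ?_
    rw [map_add, inner_add_left]
    set a := ⟪((U ^ k : unitary (H →L[ℂ] H)) : H →L[ℂ] H) ξ, η⟫_ℂ
    set b := ⟪((U ^ k : unitary (H →L[ℂ] H)) : H →L[ℂ] H) ζ, η⟫_ℂ
    have h1 := norm_add_le a b
    nlinarith [norm_nonneg (a + b), norm_nonneg a, norm_nonneg b, sq_nonneg (‖a‖ - ‖b‖)]
  have hc : (0 : ℝ) ≤ ((F n).card : ℝ)⁻¹ := by positivity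
  nlinarith [mul_le_mul_of_nonneg_left h hc]

theorem correlation_le (U : unitary (H →L[ℂ] H)) (F : ℕ → Finset ℤ) (ξ η : H) (n : ℕ) :
    correlation U F ξ η n ≤ (‖ξ‖ * ‖η‖) ^ 2 := by
  unfold correlation
  have h : ∑ k ∈ F n, ‖⟪((U ^ k : unitary (H →L[ℂ] H)) : H →L[ℂ] H) ξ, η⟫_ℂ‖ ^ 2 ≤
      ((F n).card : ℝ) * (‖ξ‖ * ‖η‖) ^ 2 := by
    rw [← nsmul_eq_mul]
    refine Finset.sum_le_card_nsmul _ _ _ fun k _ ↦ ?_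
    have h1 := norm_inner_le_norm (𝕜 := ℂ) (((U ^ k : unitary (H →L[ℂ] H)) : H →L[ℂ] H) ξ) η
    have h2 : ‖((U ^ k : unitary (H →L[ℂ] H)) : H →L[ℂ] H) ξ‖ = ‖ξ‖ :=
      (Unitary.linearIsometryEquiv (U ^ k)).norm_map ξ
    rw [h2] at h1
    gcongr
  rcases (F n).card.eq_zero_or_pos with h0 | h0
  · rw [h0]; simp; positivity
  · have h0' : (0 : ℝ) < (F n).card := by exact_mod_cast h0
    rw [inv_mul_le_iff₀ h0']
    exact h

/-- The weakly mixing part of `U`, with averages along `F`: all vectors `ξ` such that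
`|Fₙ|⁻¹ ∑_{k ∈ Fₙ} |⟪Uᵏ ξ, η⟫|² → 0` for every `η`. -/
def weaklyMixingPart (U : unitary (H →L[ℂ] H)) (F : ℕ → Finset ℤ) : Submodule ℂ H where
  carrier := {ξ | ∀ η : H, Tendsto (correlation U F ξ η) atTop (𝓝 0)}
  zero_mem' η := by
    have : correlation U F 0 η = fun _ ↦ 0 := by funext n; simp [correlation]
    rw [this]; exact tendsto_const_nhds
  add_mem' {ξ ζ} hξ hζ η := by
    refine squeeze_zero (correlation_nonneg U F _ η) (correlation_add_le U F ξ ζ η) ?_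
    simpa using ((hξ η).const_mul 2).add ((hζ η).const_mul 2)
  smul_mem' c ξ hξ η := by
    have : correlation U F (c • ξ) η = fun n ↦ ‖c‖ ^ 2 * correlation U F ξ η n := by
      funext n
      simp only [correlation, map_smul, inner_smul_left, norm_mul, RCLike.norm_conj, mul_pow]
      rw [← Finset.mul_sum]; ring
    rw [this]
    simpa using (hξ η).const_mul (‖c‖ ^ 2)

theorem isClosed_weaklyMixingPart (U : unitary (H →L[ℂ] H)) (F : ℕ → Finset ℤ) :
    IsClosed (weaklyMixingPart U F : Set H) := by
  refine isClosed_of_closure_subset fun ξ hξ η ↦ ?_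
  rw [Metric.tendsto_atTop]
  intro ε hε
  obtain ⟨δ, hδ, hδε⟩ : ∃ δ : ℝ, 0 < δ ∧ 2 * (δ * ‖η‖) ^ 2 < ε / 2 := by
    have hc : Tendsto (fun δ : ℝ ↦ 2 * (δ * ‖η‖) ^ 2) (𝓝[>] 0) (𝓝 0) := by
      have : Continuous fun δ : ℝ ↦ 2 * (δ * ‖η‖) ^ 2 := by fun_prop
      simpa using (this.tendsto 0).mono_left nhdsWithin_le_nhds
    obtain ⟨δ, h1, h2⟩ := ((hc.eventually_lt_const (half_pos hε)).and
      self_mem_nhdsWithin).exists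
    exact ⟨δ, h2, h1⟩
  obtain ⟨ζ, hζ, hd⟩ := Metric.mem_closure_iff.1 hξ δ hδ
  obtain ⟨N, hN⟩ := (Metric.tendsto_atTop.1 (hζ η)) (ε / 4) (by positivity)
  refine ⟨N, fun n hn ↦ ?_⟩
  have h1 := hN n hn
  rw [Real.dist_eq, sub_zero, abs_of_nonneg (correlation_nonneg U F _ _ _)] at h1 ⊢
  have h2 := correlation_add_le U F ζ (ξ - ζ) η n
  rw [add_sub_cancel] at h2
  have h3 := correlation_le U F (ξ - ζ) η n
  have h4 : (‖ξ - ζ‖ * ‖η‖) ^ 2 ≤ (δ * ‖η‖) ^ 2 := by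
    rw [dist_eq_norm] at hd
    gcongr
  linarith

instance weaklyMixingPart_complete (U : unitary (H →L[ℂ] H)) (F : ℕ → Finset ℤ) :
    CompleteSpace (weaklyMixingPart U F) :=
  (isClosed_weaklyMixingPart U F).completeSpace_coe

/-- `P_c`, the orthogonal projection onto the compact part. -/
def compactProj (U : unitary (H →L[ℂ] H)) : H →L[ℂ] H :=
  (compactPart U).starProjection

/-- `P_wm`, the orthogonal projection onto the weakly mixing part. -/
def weaklyMixingProj (U : unitary (H →L[ℂ] H)) (F : ℕ → Finset ℤ) : H →L[ℂ] H :=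
  (weaklyMixingPart U F).starProjection

end Parts

end NeveuBH

end

/-!
Every `*`-automorphism of `B(H)` is conjugation by a unitary `U`, which sends the rank-one operator
`ξ ⊗ ξ*` to `Uξ ⊗ (Uξ)*`. Conjugation is isometric for the Hilbert–Schmidt norm, so by the mean
ergodic theorem the averages of `ξ ⊗ ξ*` are Cauchy in that norm, hence in the operator norm. Their
limit `T` is compact, self-adjoint and commutes with `U`. If `ξ` is orthogonal to every eigenvector
of `U`, then `T` kills every eigenvector of `U`; but a nonzero eigenspace of `T` with nonzero
eigenvalue would be finite-dimensional and `U`-invariant, so it would contain one. Hence `T = 0`.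
The quadratic forms of the averages are the correlations `|Fₙ|⁻¹ ∑ |⟪Uᵏ ξ, η⟫|²`, and therefore the
weakly mixing part is the orthogonal complement of the compact part.

Separability yields square-summable sequences with dense span: one of eigenvectors in the compact
part, giving the state `∑ ⟪fₙ, · fₙ⟫`, and one in the weakly mixing part, giving the operator
`∑ fₙ ⊗ fₙ*`, whose averages tend to `0` by dominated convergence. For both, the support is the
projection onto the closed span of `f`.
-/

noncomputable section

namespace NeveuBH

open Filter Topology MeasureTheory
open scoped InnerProductSpace ComplexOrder

section Mean

variable {ι E E' : Type*}

/-- The arithmetic mean `f ↦ |F|⁻¹ ∑_{k ∈ F} f k` as a linear map; it is `0` for empty `F`. -/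
def finsetMean [AddCommGroup E] [Module ℝ E] (F : Finset ι) : (ι → E) →ₗ[ℝ] E :=
  (F.card : ℝ)⁻¹ • ∑ k ∈ F, LinearMap.proj k

theorem finsetMean_apply [AddCommGroup E] [Module ℝ E] (F : Finset ι) (f : ι → E) :
    finsetMean F f = (F.card : ℝ)⁻¹ • ∑ k ∈ F, f k := by
  simp [finsetMean]

theorem finsetMean_const [AddCommGroup E] [Module ℝ E] {F : Finset ι} (hF : 0 < F.card) (v : E) :
    finsetMean F (fun _ ↦ v) = v := by
  rw [finsetMean_apply, Finset.sum_const, ← Nat.cast_smul_eq_nsmul ℝ,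
    inv_smul_smul₀ (by positivity)]

theorem map_finsetMean [AddCommGroup E] [Module ℝ E] [AddCommGroup E'] [Module ℝ E']
    (L : E →ₗ[ℝ] E') (F : Finset ι) (f : ι → E) :
    L (finsetMean F f) = finsetMean F fun k ↦ L (f k) := by
  simp only [finsetMean_apply, map_smul, map_sum]

theorem finsetMean_mem [AddCommGroup E] [Module ℝ E] (S : Submodule ℝ E) {F : Finset ι}
    {f : ι → E} (hf : ∀ k, f k ∈ S) : finsetMean F f ∈ S := by
  rw [finsetMean_apply]
  exact S.smul_mem _ (S.sum_mem fun k _ ↦ hf k)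

theorem norm_finsetMean_le [SeminormedAddCommGroup E] [NormedSpace ℝ E] (F : Finset ι)
    {f : ι → E} {C : ℝ} (hC : 0 ≤ C) (hf : ∀ k, ‖f k‖ ≤ C) : ‖finsetMean F f‖ ≤ C := by
  have hsum : ‖∑ k ∈ F, f k‖ ≤ F.card * C := by
    simpa using norm_sum_le_of_le F fun k _ ↦ hf k
  rw [finsetMean_apply, norm_smul, norm_inv, Real.norm_natCast]
  rcases F.card.eq_zero_or_pos with h0 | h0
  · simpa [h0] using hC
  · rwa [inv_mul_le_iff₀ (by exact_mod_cast h0)]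

end Mean

section Folner

open scoped Pointwise symmDiff

variable {F : ℕ → Finset ℤ}

theorem IsFolnerSeq.eventually_card_pos (hF : IsFolnerSeq F) : ∀ᶠ n in atTop, 0 < (F n).card := by
  filter_upwards [hF.eventually_meas_ne_zero] with n hn
  rw [Finset.card_pos, Finset.nonempty_iff_ne_empty]
  rintro h
  simp [h] at hn

theorem IsFolnerSeq.tendsto_card_symmDiff (hF : IsFolnerSeq F) (j : ℤ) :
    Tendsto (fun n ↦ (((j +ᵥ F n) ∆ F n).card : ℝ) / (F n).card) atTop (𝓝 0) := by
  refine ((ENNReal.tendsto_toReal ENNReal.zero_ne_top).comp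
    (hF.tendsto_meas_vadd_symmDiff j)).congr fun n ↦ ?_
  have hcoe : (j +ᵥ (F n : Set ℤ)) ∆ (F n : Set ℤ) = (((j +ᵥ F n) ∆ F n : Finset ℤ) : Set ℤ) := by
    rw [Finset.coe_symmDiff, Finset.coe_vadd_finset]
  simp only [Function.comp_apply, hcoe, Measure.count_apply_finset, ENNReal.toReal_div,
    ENNReal.toReal_natCast]

theorem norm_sum_sub_sum_le_card_symmDiff {ι E : Type*} [DecidableEq ι] [SeminormedAddCommGroup E]
    (S T : Finset ι) {f : ι → E} {C : ℝ} (hf : ∀ k, ‖f k‖ ≤ C) :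
    ‖∑ k ∈ S, f k - ∑ k ∈ T, f k‖ ≤ (S ∆ T).card * C := by
  have hcard : (S ∆ T).card = (S \ T).card + (T \ S).card := by
    rw [symmDiff_def, Finset.sup_eq_union, Finset.card_union_of_disjoint disjoint_sdiff_sdiff]
  have hsum (R : Finset ι) : ‖∑ k ∈ R, f k‖ ≤ R.card * C := by
    simpa using norm_sum_le_of_le R fun k _ ↦ hf k
  calc ‖∑ k ∈ S, f k - ∑ k ∈ T, f k‖
      = ‖∑ k ∈ S \ T, f k - ∑ k ∈ T \ S, f k‖ := by rw [← Finset.sum_sdiff_sub_sum_sdiff]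
    _ ≤ (S \ T).card * C + (T \ S).card * C := norm_sub_le_of_le (hsum _) (hsum _)
    _ = (S ∆ T).card * C := by rw [hcard]; push_cast; ring

theorem IsFolnerSeq.tendsto_finsetMean_shift_sub {E : Type*} [SeminormedAddCommGroup E]
    [NormedSpace ℝ E] (hF : IsFolnerSeq F) {f : ℤ → E} {C : ℝ} (hf : ∀ k, ‖f k‖ ≤ C) (j : ℤ) :
    Tendsto (fun n ↦ finsetMean (F n) (fun k ↦ f (j + k)) - finsetMean (F n) f) atTop (𝓝 0) := by
  refine squeeze_zero_norm (fun n ↦ ?_)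
    (by simpa only [mul_zero] using (hF.tendsto_card_symmDiff j).const_mul C)
  have hshift : ∑ k ∈ F n, f (j + k) = ∑ k ∈ j +ᵥ F n, f k := by
    rw [Finset.vadd_finset_def, Finset.sum_image fun a _ b _ hab ↦ by simpa using hab]
    simp only [vadd_eq_add]
  rw [finsetMean_apply, finsetMean_apply, ← smul_sub, hshift, norm_smul, norm_inv,
    Real.norm_natCast, mul_div_assoc', div_eq_inv_mul, mul_comm C]
  gcongr
  exact norm_sum_sub_sum_le_card_symmDiff _ _ hf

end Folner

section MeanErgodic

variable {E : Type*} [SeminormedAddCommGroup E] [InnerProductSpace ℝ E] {F : ℕ → Finset ℤ}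

theorem norm_sub_sq_le_of_quotient_mk_eq {S : Submodule ℝ E} {x : E ⧸ S} {a b : E}
    (ha : Submodule.Quotient.mk a = x) (hb : Submodule.Quotient.mk b = x) :
    ‖a - b‖ ^ 2 ≤ 2 * (‖a‖ ^ 2 + ‖b‖ ^ 2) - (2 * ‖x‖) ^ 2 := by
  have hsum : 2 * ‖x‖ ≤ ‖a + b‖ := by
    have h := Submodule.Quotient.norm_mk_le S (a + b)
    rwa [Submodule.Quotient.mk_add, ha, hb, ← two_smul ℝ x, norm_smul, Real.norm_two] at h
  have hsq : (2 * ‖x‖) ^ 2 ≤ ‖a + b‖ ^ 2 := by gcongr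
  linarith [parallelogram_law_with_norm ℝ a b]

theorem cauchySeq_of_quotient_mk_eq_of_tendsto_norm {S : Submodule ℝ E} {x : E ⧸ S} {a : ℕ → E}
    (ha : ∀ᶠ n in atTop, Submodule.Quotient.mk (a n) = x)
    (hnorm : Tendsto (fun n ↦ ‖a n‖) atTop (𝓝 ‖x‖)) : CauchySeq a := by
  rw [cauchySeq_iff_tendsto_dist_atTop_0, ← prod_atTop_atTop_eq]
  have hlim : Tendsto (fun p : ℕ × ℕ ↦ √(2 * (‖a p.1‖ ^ 2 + ‖a p.2‖ ^ 2) - (2 * ‖x‖) ^ 2))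
      (atTop ×ˢ atTop) (𝓝 0) := by
    have h := (((((hnorm.comp tendsto_fst).pow 2).add ((hnorm.comp tendsto_snd).pow 2)).const_mul
      2).sub_const ((2 * ‖x‖) ^ 2)).sqrt
    simpa only [Function.comp_def, show √(2 * (‖x‖ ^ 2 + ‖x‖ ^ 2) - (2 * ‖x‖) ^ 2) = 0 by
      ring_nf; exact Real.sqrt_zero] using h
  refine squeeze_zero' (Eventually.of_forall fun _ ↦ dist_nonneg) ?_ hlim
  filter_upwards [ha.prod_mk ha] with p hp
  rw [dist_eq_norm]
  exact Real.le_sqrt_of_sq_le (norm_sub_sq_le_of_quotient_mk_eq hp.1 hp.2)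

/-- The mean over `F` of the orbit of a vector under isometries indexed by `ℤ`. -/
def orbitMean (ρ : ℤ → E →ₗᵢ[ℝ] E) (F : Finset ℤ) : E →ₗ[ℝ] E :=
  finsetMean F ∘ₗ LinearMap.pi fun k ↦ (ρ k).toLinearMap

theorem orbitMean_apply (ρ : ℤ → E →ₗᵢ[ℝ] E) (F : Finset ℤ) (v : E) :
    orbitMean ρ F v = finsetMean F fun k ↦ ρ k v := rfl

theorem norm_orbitMean_le (ρ : ℤ → E →ₗᵢ[ℝ] E) (F : Finset ℤ) (v : E) :
    ‖orbitMean ρ F v‖ ≤ ‖v‖ :=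
  norm_finsetMean_le F (norm_nonneg v) fun k ↦ ((ρ k).norm_map v).le

/-- The vectors whose orbit means along `F` tend to `0`. The orbit means of `v` all lie in the coset
of `v`, and their norms converge to its quotient norm. -/
def nullMeanSubmodule (ρ : ℤ → E →ₗᵢ[ℝ] E) (F : ℕ → Finset ℤ) : Submodule ℝ E where
  carrier := {v | Tendsto (fun n ↦ orbitMean ρ (F n) v) atTop (𝓝 0)}
  zero_mem' := by simp only [Set.mem_ofPred_eq, map_zero, tendsto_const_nhds]
  add_mem' hv hw := by simpa only [Set.mem_ofPred_eq, map_add, add_zero] using hv.add hw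
  smul_mem' c v hv := by simpa only [Set.mem_ofPred_eq, map_smul, smul_zero] using hv.const_smul c

variable {ρ : ℤ → E →ₗᵢ[ℝ] E}

theorem map_sub_self_mem_nullMeanSubmodule (hF : IsFolnerSeq F)
    (hρ : ∀ j k v, ρ (j + k) v = ρ j (ρ k v)) (j : ℤ) (v : E) :
    ρ j v - v ∈ nullMeanSubmodule ρ F := by
  refine (hF.tendsto_finsetMean_shift_sub (f := fun k ↦ ρ k v)
    (fun k ↦ ((ρ k).norm_map v).le) j).congr fun n ↦ ?_
  simp only [map_sub, orbitMean_apply, ← hρ, add_comm]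

theorem quotient_mk_orbitMean (hF : IsFolnerSeq F) (hρ : ∀ j k v, ρ (j + k) v = ρ j (ρ k v))
    {G : Finset ℤ} (hG : 0 < G.card) (v : E) :
    (Submodule.Quotient.mk (orbitMean ρ G v) : E ⧸ nullMeanSubmodule ρ F) =
      Submodule.Quotient.mk v := by
  rw [Submodule.Quotient.eq]
  nth_rw 2 [← finsetMean_const hG v]
  rw [orbitMean_apply, ← map_sub]
  exact finsetMean_mem _ fun k ↦ map_sub_self_mem_nullMeanSubmodule hF hρ k v

theorem tendsto_norm_orbitMean (hF : IsFolnerSeq F) (hρ : ∀ j k v, ρ (j + k) v = ρ j (ρ k v))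
    (v : E) : Tendsto (fun n ↦ ‖orbitMean ρ (F n) v‖) atTop
      (𝓝 ‖(Submodule.Quotient.mk v : E ⧸ nullMeanSubmodule ρ F)‖) := by
  refine tendsto_order.2 ⟨fun r hr ↦ ?_, fun r hr ↦ ?_⟩
  · filter_upwards [hF.eventually_card_pos] with n hn
    rw [← quotient_mk_orbitMean hF hρ hn v] at hr
    exact hr.trans_le (Submodule.Quotient.norm_mk_le _ _)
  · obtain ⟨w, hw, hwr⟩ := Submodule.Quotient.norm_mk_lt
      (Submodule.Quotient.mk v : E ⧸ nullMeanSubmodule ρ F) (sub_pos.2 hr)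
    have hnull : Tendsto (fun n ↦ ‖orbitMean ρ (F n) (v - w)‖) atTop (𝓝 0) :=
      tendsto_zero_iff_norm_tendsto_zero.1 ((Submodule.Quotient.eq _).1 hw.symm)
    rw [add_sub_cancel] at hwr
    filter_upwards [hnull.eventually_lt_const (sub_pos.2 hwr)] with n hn
    calc ‖orbitMean ρ (F n) v‖ = ‖orbitMean ρ (F n) (v - w) + orbitMean ρ (F n) w‖ := by
          rw [← map_add, sub_add_cancel]
      _ ≤ ‖orbitMean ρ (F n) (v - w)‖ + ‖w‖ := norm_add_le_of_le le_rfl (norm_orbitMean_le ρ _ w)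
      _ < r := by linarith

theorem cauchySeq_orbitMean (hF : IsFolnerSeq F) (hρ : ∀ j k v, ρ (j + k) v = ρ j (ρ k v))
    (v : E) : CauchySeq fun n ↦ orbitMean ρ (F n) v :=
  cauchySeq_of_quotient_mk_eq_of_tendsto_norm
    (hF.eventually_card_pos.mono fun _ hn ↦ quotient_mk_orbitMean hF hρ hn v)
    (tendsto_norm_orbitMean hF hρ v)

end MeanErgodic

section Average

variable {H : Type*} [NormedAddCommGroup H] [InnerProductSpace ℂ H] [CompleteSpace H]
  {α : (H →L[ℂ] H) ≃⋆ₐ[ℂ] (H →L[ℂ] H)} {F : ℕ → Finset ℤ} {x T : H →L[ℂ] H}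

theorem average_eq_finsetMean (α : (H →L[ℂ] H) ≃⋆ₐ[ℂ] (H →L[ℂ] H)) (F : ℕ → Finset ℤ) (n : ℕ)
    (x : H →L[ℂ] H) : average α F n x = finsetMean (F n) fun k ↦ (α ^ k) x := by
  rw [average, finsetMean_apply, ← Complex.coe_smul, Complex.ofReal_inv, Complex.ofReal_natCast]

theorem norm_average_le (α : (H →L[ℂ] H) ≃⋆ₐ[ℂ] (H →L[ℂ] H)) (F : ℕ → Finset ℤ) (n : ℕ)
    (x : H →L[ℂ] H) : ‖average α F n x‖ ≤ ‖x‖ := by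
  rw [average_eq_finsetMean]
  exact norm_finsetMean_le _ (norm_nonneg x) fun k ↦ (StarAlgEquiv.norm_map (α ^ k) x).le

theorem map_eq_of_tendsto_average (hF : IsFolnerSeq F)
    (hT : Tendsto (fun n ↦ average α F n x) atTop (𝓝 T)) : α T = T := by
  have hα : Tendsto (fun n ↦ α (average α F n x)) atTop (𝓝 (α T)) :=
    ((StarAlgEquiv.isometry α).continuous.tendsto T).comp hT
  refine sub_eq_zero.1 (tendsto_nhds_unique (hα.sub hT) ?_)
  refine (hF.tendsto_finsetMean_shift_sub (f := fun k ↦ (α ^ k) x)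
    (fun k ↦ (StarAlgEquiv.norm_map (α ^ k) x).le) 1).congr fun n ↦ ?_
  simp only [average_eq_finsetMean, finsetMean_apply, zpow_one_add, StarAlgEquiv.mul_apply]
  congr 1
  rw [← Complex.coe_smul, ← Complex.coe_smul, map_smul, map_sum]

theorem mem_of_tendsto_average {S : Submodule ℝ (H →L[ℂ] H)} (hS : IsClosed (S : Set (H →L[ℂ] H)))
    (hx : ∀ k : ℤ, (α ^ k) x ∈ S) (hT : Tendsto (fun n ↦ average α F n x) atTop (𝓝 T)) :
    T ∈ S := by
  refine hS.mem_of_tendsto hT (Eventually.of_forall fun n ↦ ?_)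
  rw [average_eq_finsetMean]
  exact finsetMean_mem S hx

theorem hasSum_average {y : ℕ → H →L[ℂ] H} (hy : HasSum y x) (n : ℕ) :
    HasSum (fun i ↦ average α F n (y i)) (average α F n x) :=
  HasSum.const_smul _ <| hasSum_sum fun k _ ↦
    hy.map (α ^ k) (StarAlgEquiv.isometry (α ^ k)).continuous

theorem tendsto_average_zero_of_hasSum {y : ℕ → H →L[ℂ] H} (hy : Summable fun i ↦ ‖y i‖)
    (hyx : HasSum y x) (hlim : ∀ i, Tendsto (fun n ↦ average α F n (y i)) atTop (𝓝 0)) :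
    Tendsto (fun n ↦ average α F n x) atTop (𝓝 0) := by
  simp only [← (hasSum_average hyx _).tsum_eq]
  rw [← tsum_zero (β := ℕ) (α := H →L[ℂ] H)]
  exact tendsto_tsum_of_dominated_convergence hy hlim
    (Eventually.of_forall fun n i ↦ norm_average_le α F n (y i))

end Average

section Conjugation

open InnerProductSpace

variable {H : Type*} [NormedAddCommGroup H] [InnerProductSpace ℂ H] [CompleteSpace H]

theorem conjStarAlgAut_rankOne (U : unitary (H →L[ℂ] H)) (a b : H) :
    Unitary.conjStarAlgAut ℂ _ U (rankOne ℂ a b) =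
      rankOne ℂ ((U : H →L[ℂ] H) a) ((U : H →L[ℂ] H) b) := by
  ext η
  simp [ContinuousLinearMap.star_eq_adjoint, ContinuousLinearMap.adjoint_inner_right]

theorem conjStarAlgAut_zpow_rankOne (U : unitary (H →L[ℂ] H)) (k : ℤ) (a b : H) :
    (Unitary.conjStarAlgAut ℂ _ U ^ k) (rankOne ℂ a b) =
      rankOne ℂ (((U ^ k : unitary (H →L[ℂ] H)) : H →L[ℂ] H) a)
        (((U ^ k : unitary (H →L[ℂ] H)) : H →L[ℂ] H) b) := by
  rw [← map_zpow, conjStarAlgAut_rankOne]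

theorem commute_of_conjStarAlgAut_eq_self {U : unitary (H →L[ℂ] H)} {T : H →L[ℂ] H}
    (h : Unitary.conjStarAlgAut ℂ _ U T = T) : Commute (U : H →L[ℂ] H) T := by
  rw [Unitary.conjStarAlgAut_apply] at h
  rw [Commute, SemiconjBy]
  nth_rw 2 [← h]
  rw [mul_assoc _ _ (U : H →L[ℂ] H), Unitary.coe_star_mul_self, mul_one]

theorem exists_unitary_of_starAlgEquiv (α : (H →L[ℂ] H) ≃⋆ₐ[ℂ] (H →L[ℂ] H)) :
    ∃ U : unitary (H →L[ℂ] H), ∀ x, α x = U * x * star (U : H →L[ℂ] H) := by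
  obtain ⟨e, he⟩ := StarAlgEquiv.eq_linearIsometryEquivConjStarAlgEquiv α
    (StarAlgEquiv.isometry α).continuous
  refine ⟨Unitary.linearIsometryEquiv.symm e, fun x ↦ ?_⟩
  rw [he, ← Unitary.conjStarAlgAut_symm_unitaryLinearIsometryEquiv, Unitary.conjStarAlgAut_apply]

theorem norm_eq_one_of_unitary_apply_eq_smul {U : unitary (H →L[ℂ] H)} {μ : ℂ} {v : H}
    (hv0 : v ≠ 0) (hv : (U : H →L[ℂ] H) v = μ • v) : ‖μ‖ = 1 := by
  have h := Unitary.norm_map U v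
  rw [hv, norm_smul] at h
  exact (mul_eq_right₀ (norm_ne_zero_iff.2 hv0)).1 h

theorem inner_conjStarAlgAut_apply_self {U : unitary (H →L[ℂ] H)} {μ : ℂ} {v : H}
    (hv : (U : H →L[ℂ] H) v = μ • v) (x : H →L[ℂ] H) :
    ⟪v, Unitary.conjStarAlgAut ℂ _ U x v⟫_ℂ = ⟪v, x v⟫_ℂ := by
  rcases eq_or_ne v 0 with rfl | hv0
  · simp only [inner_zero_left]
  have hμ : starRingEnd ℂ μ * μ = 1 := by
    rw [Complex.conj_mul', norm_eq_one_of_unitary_apply_eq_smul hv0 hv, Complex.ofReal_one, one_pow]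
  have hstar : v = μ • star (U : H →L[ℂ] H) v := by
    rw [← map_smul, ← hv, ← mul_apply_eq_comp, Unitary.coe_star_mul_self, one_apply_eq_self]
  calc ⟪v, Unitary.conjStarAlgAut ℂ _ U x v⟫_ℂ
      = ⟪star (U : H →L[ℂ] H) v, x (star (U : H →L[ℂ] H) v)⟫_ℂ := by
        rw [Unitary.conjStarAlgAut_apply, mul_apply_eq_comp, mul_apply_eq_comp,
          ContinuousLinearMap.star_eq_adjoint, ContinuousLinearMap.adjoint_inner_left]
    _ = ⟪μ • star (U : H →L[ℂ] H) v, x (μ • star (U : H →L[ℂ] H) v)⟫_ℂ := by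
        rw [map_smul, inner_smul_left, inner_smul_right, ← mul_assoc, hμ, one_mul]
    _ = ⟪v, x v⟫_ℂ := by rw [← hstar]

theorem norm_inner_unitary_apply_left {U : unitary (H →L[ℂ] H)} {μ : ℂ} {v : H}
    (hv : (U : H →L[ℂ] H) v = μ • v) (ξ : H) :
    ‖⟪(U : H →L[ℂ] H) ξ, v⟫_ℂ‖ = ‖⟪ξ, v⟫_ℂ‖ := by
  rcases eq_or_ne v 0 with rfl | hv0
  · simp only [inner_zero_right]
  rw [← Unitary.inner_map_map U ξ v, hv, inner_smul_right, norm_mul,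
    norm_eq_one_of_unitary_apply_eq_smul hv0 hv, one_mul]

theorem norm_inner_unitary_zpow_apply_left {U : unitary (H →L[ℂ] H)} {μ : ℂ} {v : H}
    (hv : (U : H →L[ℂ] H) v = μ • v) (k : ℤ) (ξ : H) :
    ‖⟪((U ^ k : unitary (H →L[ℂ] H)) : H →L[ℂ] H) ξ, v⟫_ℂ‖ = ‖⟪ξ, v⟫_ℂ‖ := by
  have hstep (j : ℤ) : ‖⟪((U ^ (j + 1) : unitary (H →L[ℂ] H)) : H →L[ℂ] H) ξ, v⟫_ℂ‖ =
      ‖⟪((U ^ j : unitary (H →L[ℂ] H)) : H →L[ℂ] H) ξ, v⟫_ℂ‖ := by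
    rw [add_comm, zpow_one_add]
    exact norm_inner_unitary_apply_left hv _
  induction k with
  | zero => simp
  | succ n ih => rw [hstep, ih]
  | pred n ih => rw [← hstep, sub_add_cancel, ih]

end Conjugation

section HilbertSchmidt

open TensorProduct InnerProductSpace

attribute [local instance] InnerProductSpace.complexToReal

variable {H : Type*} [NormedAddCommGroup H] [InnerProductSpace ℂ H]

/-- The real-linear map sending `a ⊗ b` to the rank-one operator `η ↦ ⟪b, η⟫ a`. It identifies the
tensor square of `H` with the finite-rank operators carrying the Hilbert–Schmidt inner product. The
tensor product is real because the rank-one operator is conjugate-linear in `b`. -/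
def tensorToOperator (H : Type*) [NormedAddCommGroup H] [InnerProductSpace ℂ H] :
    H ⊗[ℝ] H →ₗ[ℝ] (H →L[ℂ] H) :=
  TensorProduct.lift <| LinearMap.mk₂ ℝ (fun a b ↦ rankOne ℂ a b)
    (fun a a' b ↦ by simp)
    (fun c a b ↦ by ext η; exact smul_comm ⟪b, η⟫_ℂ c a)
    (fun a b b' ↦ by simp)
    (fun c a b ↦ by ext η; simp [mul_smul])

@[simp]
theorem tensorToOperator_tmul (a b : H) : tensorToOperator H (a ⊗ₜ[ℝ] b) = rankOne ℂ a b := rfl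

theorem re_inner_tensorToOperator (t : H ⊗[ℝ] H) (ζ η : H) :
    RCLike.re ⟪ζ, tensorToOperator H t η⟫_ℂ =
      ⟪ζ ⊗ₜ[ℝ] η, t⟫_ℝ + ⟪(Complex.I • ζ) ⊗ₜ[ℝ] (Complex.I • η), t⟫_ℝ := by
  induction t with
  | zero => simp
  | add x y hx hy =>
    simp only [map_add, _root_.add_apply, inner_add_right, hx, hy]
    ring
  | tmul a b =>
    simp only [tensorToOperator_tmul, rankOne_apply, inner_smul_right, TensorProduct.inner_tmul,
      real_inner_eq_re_inner ℂ, inner_smul_left]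
    have hre : (⟪η, b⟫_ℂ).re = (⟪b, η⟫_ℂ).re := inner_re_symm (𝕜 := ℂ) η b
    have him : (⟪η, b⟫_ℂ).im = -(⟪b, η⟫_ℂ).im := inner_im_symm (𝕜 := ℂ) η b
    simp [hre, him]
    ring

theorem norm_tensorToOperator_le (t : H ⊗[ℝ] H) : ‖tensorToOperator H t‖ ≤ 2 * ‖t‖ := by
  refine ContinuousLinearMap.opNorm_le_of_re_inner_le (by positivity) fun η ζ hη hζ ↦ ?_
  rw [inner_re_symm, re_inner_tensorToOperator]
  have h₁ := real_inner_le_norm (ζ ⊗ₜ[ℝ] η) t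
  have h₂ := real_inner_le_norm ((Complex.I • ζ) ⊗ₜ[ℝ] (Complex.I • η)) t
  simp only [TensorProduct.norm_tmul, norm_smul, Complex.norm_I, hη, hζ, one_mul] at h₁ h₂
  linarith

variable [CompleteSpace H]

/-- The action `a ⊗ b ↦ U ^ k a ⊗ U ^ k b` of `ℤ` on the real tensor square of `H`, which
`tensorToOperator` intertwines with conjugation by the powers of `U`. -/
def tensorAction (U : unitary (H →L[ℂ] H)) (k : ℤ) : H ⊗[ℝ] H →ₗᵢ[ℝ] H ⊗[ℝ] H :=
  let W : H →ₗᵢ[ℝ] H :=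
    { toLinearMap := ((U ^ k : unitary (H →L[ℂ] H)) : H →L[ℂ] H).toLinearMap.restrictScalars ℝ
      norm_map' := Unitary.norm_map (U ^ k) }
  TensorProduct.mapIsometry W W

@[simp]
theorem tensorAction_tmul (U : unitary (H →L[ℂ] H)) (k : ℤ) (a b : H) :
    tensorAction U k (a ⊗ₜ[ℝ] b) = (((U ^ k : unitary (H →L[ℂ] H)) : H →L[ℂ] H) a) ⊗ₜ[ℝ]
      (((U ^ k : unitary (H →L[ℂ] H)) : H →L[ℂ] H) b) := rfl

theorem tensorAction_add (U : unitary (H →L[ℂ] H)) (j k : ℤ) (t : H ⊗[ℝ] H) :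
    tensorAction U (j + k) t = tensorAction U j (tensorAction U k t) := by
  induction t with
  | zero => simp only [map_zero]
  | add x y hx hy => simp only [map_add, hx, hy]
  | tmul a b => simp only [tensorAction_tmul, zpow_add, Submonoid.coe_mul, mul_apply_eq_comp]

theorem tensorToOperator_tensorAction (U : unitary (H →L[ℂ] H)) (k : ℤ) (t : H ⊗[ℝ] H) :
    tensorToOperator H (tensorAction U k t) =
      (Unitary.conjStarAlgAut ℂ _ U ^ k) (tensorToOperator H t) := by
  induction t with
  | zero => simp only [map_zero]
  | add x y hx hy => simp only [map_add, hx, hy]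
  | tmul a b => rw [tensorAction_tmul, tensorToOperator_tmul, tensorToOperator_tmul,
      conjStarAlgAut_zpow_rankOne]

theorem cauchySeq_average_tensorToOperator {F : ℕ → Finset ℤ} (hF : IsFolnerSeq F)
    (U : unitary (H →L[ℂ] H)) (t : H ⊗[ℝ] H) :
    CauchySeq fun n ↦ average (Unitary.conjStarAlgAut ℂ _ U) F n (tensorToOperator H t) := by
  have hmap (n : ℕ) : average (Unitary.conjStarAlgAut ℂ _ U) F n (tensorToOperator H t) =
      tensorToOperator H (orbitMean (tensorAction U) (F n) t) := by
    simp only [average_eq_finsetMean, orbitMean_apply, map_finsetMean,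
      tensorToOperator_tensorAction]
  simp only [hmap]
  exact (AddMonoidHomClass.uniformContinuous_of_bound (tensorToOperator H) 2
    norm_tensorToOperator_le).comp_cauchySeq (cauchySeq_orbitMean hF (tensorAction_add U) t)

end HilbertSchmidt

section Decomposition

open InnerProductSpace

variable {H : Type*} [NormedAddCommGroup H] [InnerProductSpace ℂ H]

theorem isCompactOperator_rankOne (a b : H) : IsCompactOperator (rankOne ℂ a b) := by
  rw [rankOne_def']
  exact (isCompactOperator_of_locallyCompactSpace_dom (innerSL ℂ b)).clm_comp
    (ContinuousLinearMap.toSpanSingleton ℂ a)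

theorem inner_rankOne_self_apply (ξ η : H) :
    ⟪η, rankOne ℂ ξ ξ η⟫_ℂ = ((‖⟪ξ, η⟫_ℂ‖ ^ 2 : ℝ) : ℂ) := by
  rw [rankOne_apply, inner_smul_right, ← inner_conj_symm η, Complex.mul_conj,
    Complex.normSq_eq_norm_sq]

variable [CompleteSpace H]

theorem eq_zero_of_commute_of_forall_eigenvector {T B : H →L[ℂ] H} (hT : IsCompactOperator T)
    (hsymm : (T : H →ₗ[ℂ] H).IsSymmetric) (hcomm : Commute B T)
    (hB : ∀ (μ : ℂ) (v : H), B v = μ • v → T v = 0) : T = 0 := by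
  refine (ContinuousLinearMap.eq_zero_of_forall_hasEigenvalue_eq_zero hT hsymm).1 fun c hc ↦ ?_
  by_contra hc0
  let V := Module.End.eigenspace (T : H →ₗ[ℂ] H) c
  have : FiniteDimensional ℂ V := T.finite_dimensional_eigenspace hT c hc0
  have : Nontrivial V := (Submodule.nontrivial_iff_ne_bot).2 hc
  have hinv : ∀ v ∈ V, (B : H →ₗ[ℂ] H) v ∈ V :=
    Module.End.mapsTo_genEigenspace_of_comm
      (hcomm.symm.map ContinuousLinearMap.toLinearMapRingHom) c 1
  obtain ⟨μ, hμ⟩ := Module.End.exists_eigenvalue ((B : H →ₗ[ℂ] H).restrict hinv)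
  obtain ⟨⟨v, hvV⟩, hv⟩ := hμ.exists_hasEigenvector
  have hBv : B v = μ • v := congr_arg Subtype.val hv.apply_eq_smul
  have hTv : T v = c • v := Module.End.mem_eigenspace_iff.1 hvV
  rw [hB μ v hBv, eq_comm, smul_eq_zero] at hTv
  exact hTv.elim hc0 fun h0 ↦ hv.2 (Subtype.ext h0)

theorem mem_orthogonal_compactPart_iff {U : unitary (H →L[ℂ] H)} {ξ : H} :
    ξ ∈ (compactPart U)ᗮ ↔ ∀ μ : ℂ, ∀ v : H, (U : H →L[ℂ] H) v = μ • v → ⟪ξ, v⟫_ℂ = 0 := by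
  rw [compactPart, Submodule.orthogonal_closure, ← Submodule.iInf_orthogonal, Submodule.mem_iInf]
  refine forall_congr' fun μ ↦ ?_
  rw [Submodule.mem_orthogonal']
  exact forall_congr' fun v ↦ imp_congr_left Module.End.mem_eigenspace_iff

theorem cauchySeq_average_rankOne {F : ℕ → Finset ℤ} (hF : IsFolnerSeq F)
    (U : unitary (H →L[ℂ] H)) (a b : H) :
    CauchySeq fun n ↦ average (Unitary.conjStarAlgAut ℂ _ U) F n (rankOne ℂ a b) :=
  cauchySeq_average_tensorToOperator hF U (a ⊗ₜ b)

theorem tendsto_average_rankOne_zero {F : ℕ → Finset ℤ} (hF : IsFolnerSeq F)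
    {U : unitary (H →L[ℂ] H)} {ξ : H} (hξ : ξ ∈ (compactPart U)ᗮ) :
    Tendsto (fun n ↦ average (Unitary.conjStarAlgAut ℂ _ U) F n (rankOne ℂ ξ ξ)) atTop (𝓝 0) := by
  obtain ⟨T, hT⟩ := cauchySeq_tendsto_of_complete (cauchySeq_average_rankOne hF U ξ ξ)
  have hcompact : IsCompactOperator T :=
    mem_of_tendsto_average (S := (compactOperator (RingHom.id ℂ) H H).restrictScalars ℝ)
      isClosed_setOfPred_isCompactOperator
      (fun k ↦ by
        rw [conjStarAlgAut_zpow_rankOne]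
        exact isCompactOperator_rankOne _ _) hT
  have hselfAdjoint : IsSelfAdjoint T :=
    mem_of_tendsto_average (S := selfAdjoint.submodule ℝ (H →L[ℂ] H))
      (isClosed_eq continuous_star continuous_id)
      (fun k ↦ by
        rw [conjStarAlgAut_zpow_rankOne]
        exact (isPositive_rankOne_self _).isSelfAdjoint) hT
  have hcomm : Commute (U : H →L[ℂ] H) T :=
    commute_of_conjStarAlgAut_eq_self (map_eq_of_tendsto_average hF hT)
  have hker (μ : ℂ) (v : H) (hv : (U : H →L[ℂ] H) v = μ • v) : T v = 0 :=
    mem_of_tendsto_average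
      (S := (LinearMap.ker (ContinuousLinearMap.apply ℂ H v).toLinearMap).restrictScalars ℝ)
      (ContinuousLinearMap.apply ℂ H v).isClosed_ker
      (fun k ↦ by
        have h0 : ⟪((U ^ k : unitary (H →L[ℂ] H)) : H →L[ℂ] H) ξ, v⟫_ℂ = 0 := by
          rw [← norm_eq_zero, norm_inner_unitary_zpow_apply_left hv, norm_eq_zero]
          exact mem_orthogonal_compactPart_iff.1 hξ μ v hv
        rw [conjStarAlgAut_zpow_rankOne]
        simp [h0]) hT
  rwa [eq_zero_of_commute_of_forall_eigenvector hcompact hselfAdjoint.isSymmetric hcomm hker] at hT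

theorem inner_average_rankOne_self (U : unitary (H →L[ℂ] H)) (F : ℕ → Finset ℤ) (n : ℕ)
    (ξ η : H) : ⟪η, average (Unitary.conjStarAlgAut ℂ _ U) F n (rankOne ℂ ξ ξ) η⟫_ℂ =
      (correlation U F ξ η n : ℂ) := by
  simp only [average, conjStarAlgAut_zpow_rankOne, _root_.smul_apply, _root_.sum_apply,
    inner_smul_right, inner_sum, inner_rankOne_self_apply, correlation, Complex.ofReal_mul,
    Complex.ofReal_inv, Complex.ofReal_natCast, Complex.ofReal_sum]

theorem orthogonal_compactPart_le_weaklyMixingPart {F : ℕ → Finset ℤ} (hF : IsFolnerSeq F)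
    (U : unitary (H →L[ℂ] H)) : (compactPart U)ᗮ ≤ weaklyMixingPart U F := by
  intro ξ hξ η
  have happly := ((ContinuousLinearMap.apply ℂ H η).continuous.tendsto 0).comp
    (tendsto_average_rankOne_zero hF hξ)
  have hinner := Filter.Tendsto.inner (𝕜 := ℂ) (tendsto_const_nhds (x := η)) happly
  simp only [Function.comp_apply, ContinuousLinearMap.apply_apply, inner_average_rankOne_self,
    map_zero, inner_zero_right] at hinner
  exact tendsto_ofReal_iff.1 hinner

theorem weaklyMixingPart_le_orthogonal_compactPart {F : ℕ → Finset ℤ} (hF : IsFolnerSeq F)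
    (U : unitary (H →L[ℂ] H)) : weaklyMixingPart U F ≤ (compactPart U)ᗮ := by
  intro ξ hξ
  rw [mem_orthogonal_compactPart_iff]
  intro μ v hv
  have hconst : ∀ᶠ n in atTop, correlation U F ξ v n = ‖⟪ξ, v⟫_ℂ‖ ^ 2 := by
    filter_upwards [hF.eventually_card_pos] with n hn
    simp only [correlation, norm_inner_unitary_zpow_apply_left hv, Finset.sum_const, nsmul_eq_mul]
    rw [inv_mul_cancel_left₀ (by positivity)]
  have hlim := tendsto_nhds_unique (tendsto_const_nhds.congr' (EventuallyEq.symm hconst)) (hξ v)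
  exact norm_eq_zero.1 (pow_eq_zero_iff two_ne_zero |>.1 hlim)

theorem weaklyMixingPart_eq_orthogonal_compactPart {F : ℕ → Finset ℤ} (hF : IsFolnerSeq F)
    (U : unitary (H →L[ℂ] H)) : weaklyMixingPart U F = (compactPart U)ᗮ :=
  le_antisymm (weaklyMixingPart_le_orthogonal_compactPart hF U)
    (orthogonal_compactPart_le_weaklyMixingPart hF U)

theorem compactProj_add_weaklyMixingProj {F : ℕ → Finset ℤ} (hF : IsFolnerSeq F)
    (U : unitary (H →L[ℂ] H)) : compactProj U + weaklyMixingProj U F = 1 := by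
  simp only [compactProj, weaklyMixingProj, weaklyMixingPart_eq_orthogonal_compactPart hF U]
  rw [Submodule.starProjection_orthogonal', add_sub_cancel]

end Decomposition

section SquareSummable

variable {𝕜 V : Type*} [RCLike 𝕜] [NormedAddCommGroup V] [NormedSpace 𝕜 V]

theorem exists_summable_norm_sq_subset_closure_span {E : Set V}
    (hE : TopologicalSpace.IsSeparable E) (hne : E.Nonempty)
    (hsmul : ∀ (c : 𝕜), ∀ v ∈ E, c • v ∈ E) :
    ∃ f : ℕ → V, (∀ n, f n ∈ E) ∧ Summable (fun n ↦ ‖f n‖ ^ 2) ∧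
      E ⊆ (Submodule.span 𝕜 (Set.range f)).topologicalClosure := by
  have := hE.separableSpace
  have := hne.to_subtype
  let e : ℕ → V := fun n ↦ TopologicalSpace.denseSeq E n
  let c : ℕ → ℝ := fun n ↦ (1 / 2) ^ n / (1 + ‖e n‖)
  have hc (n : ℕ) : 0 < c n := by positivity
  have hnorm (n : ℕ) : ‖(c n : 𝕜) • e n‖ ≤ (1 / 2) ^ n := by
    rw [norm_smul, RCLike.norm_ofReal, abs_of_pos (hc n), div_mul_eq_mul_div,
      div_le_iff₀ (by positivity)]
    gcongr
    linarith
  refine ⟨fun n ↦ (c n : 𝕜) • e n, fun n ↦ hsmul _ _ (Subtype.coe_prop _), ?_, ?_⟩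
  · refine Summable.of_nonneg_of_le (fun n ↦ by positivity) (fun n ↦ ?_)
      (summable_geometric_of_lt_one (r := 1 / 4) (by norm_num) (by norm_num))
    calc ‖(c n : 𝕜) • e n‖ ^ 2 ≤ ((1 / 2) ^ n) ^ 2 := by gcongr; exact hnorm n
      _ = (1 / 4) ^ n := by rw [← pow_mul, mul_comm, pow_mul]; norm_num
  · have he (n : ℕ) : e n ∈ Submodule.span 𝕜 (Set.range fun n ↦ (c n : 𝕜) • e n) :=
      (Submodule.smul_mem_iff _ (RCLike.ofReal_ne_zero.2 (hc n).ne')).1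
        (Submodule.subset_span ⟨n, rfl⟩)
    have hdense : E ⊆ closure (Set.range e) := by
      intro v hv
      have h := mem_closure_image continuous_subtype_val.continuousAt
        (TopologicalSpace.denseRange_denseSeq E ⟨v, hv⟩)
      rwa [← Set.range_comp] at h
    exact hdense.trans (closure_mono (Set.range_subset_iff.2 he))

theorem exists_hasSum_norm_sq_one_subset_closure_span {E : Set V}
    (hE : TopologicalSpace.IsSeparable E) {v : V} (hv : v ∈ E) (hv0 : v ≠ 0)
    (hsmul : ∀ (c : 𝕜), ∀ v ∈ E, c • v ∈ E) :
    ∃ f : ℕ → V, (∀ n, f n ∈ E) ∧ HasSum (fun n ↦ ‖f n‖ ^ 2) 1 ∧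
      E ⊆ (Submodule.span 𝕜 (Set.range f)).topologicalClosure := by
  obtain ⟨f, hfE, hf, hspan⟩ := exists_summable_norm_sq_subset_closure_span hE ⟨v, hv⟩ hsmul
  have hpos : 0 < ∑' n, ‖f n‖ ^ 2 := by
    refine (tsum_nonneg fun n ↦ by positivity).lt_of_ne' fun h ↦ hv0 ?_
    have hzero : f = 0 := by
      funext n
      simpa using congr_fun ((hasSum_zero_iff_of_nonneg fun n ↦ sq_nonneg ‖f n‖).1
        (h ▸ hf.hasSum)) n
    simpa [hzero] using hspan hv
  let c : ℝ := (√(∑' n, ‖f n‖ ^ 2))⁻¹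
  have hc : (c : 𝕜) ≠ 0 := RCLike.ofReal_ne_zero.2 (inv_ne_zero (Real.sqrt_ne_zero'.2 hpos))
  refine ⟨fun n ↦ (c : 𝕜) • f n, fun n ↦ hsmul _ _ (hfE n), ?_, ?_⟩
  · have hsum := hf.hasSum.mul_left (c ^ 2)
    rw [inv_pow, Real.sq_sqrt hpos.le, inv_mul_cancel₀ hpos.ne'] at hsum
    refine hsum.congr_fun fun n ↦ ?_
    rw [norm_smul, RCLike.norm_ofReal, mul_pow, sq_abs, inv_pow, Real.sq_sqrt hpos.le]
  · refine hspan.trans (Submodule.topologicalClosure_mono (Submodule.span_le.2 ?_))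
    rintro _ ⟨n, rfl⟩
    exact (Submodule.smul_mem_iff _ hc).1 (Submodule.subset_span ⟨n, rfl⟩)

end SquareSummable

section Support

open InnerProductSpace

variable {H : Type*} [NormedAddCommGroup H] [InnerProductSpace ℂ H] {f : ℕ → H}

theorem summable_inner_apply (hf : Summable fun n ↦ ‖f n‖ ^ 2) (x : H →L[ℂ] H) :
    Summable fun n ↦ ⟪f n, x (f n)⟫_ℂ := by
  refine Summable.of_norm_bounded (hf.mul_left ‖x‖) fun n ↦ ?_
  calc ‖⟪f n, x (f n)⟫_ℂ‖ ≤ ‖f n‖ * (‖x‖ * ‖f n‖) :=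
        (norm_inner_le_norm _ _).trans (by gcongr; exact x.le_opNorm _)
    _ = ‖x‖ * ‖f n‖ ^ 2 := by ring

theorem summable_norm_sq_apply (hf : Summable fun n ↦ ‖f n‖ ^ 2) (x : H →L[ℂ] H) :
    Summable fun n ↦ ‖x (f n)‖ ^ 2 := by
  refine Summable.of_nonneg_of_le (fun _ ↦ by positivity) (fun n ↦ ?_) (hf.mul_left (‖x‖ ^ 2))
  rw [← mul_pow]
  gcongr
  exact x.le_opNorm _

/-- The functional `x ↦ ∑ₙ ⟪fₙ, x fₙ⟫` of a square-summable sequence `f`; it is a normal state when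
`∑ₙ ‖fₙ‖² = 1`. -/
def vectorFunctional (f : ℕ → H) (hf : Summable fun n ↦ ‖f n‖ ^ 2) : (H →L[ℂ] H) →ₗ[ℂ] ℂ where
  toFun x := ∑' n, ⟪f n, x (f n)⟫_ℂ
  map_add' x y := by
    simp only [_root_.add_apply, inner_add_right]
    exact (summable_inner_apply hf x).tsum_add (summable_inner_apply hf y)
  map_smul' c x := by
    simp only [_root_.smul_apply, inner_smul_right, tsum_mul_left, smul_eq_mul, RingHom.id_apply]

theorem vectorFunctional_apply (hf : Summable fun n ↦ ‖f n‖ ^ 2) (x : H →L[ℂ] H) :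
    vectorFunctional f hf x = ∑' n, ⟪f n, x (f n)⟫_ℂ := rfl

/-- The positive operator `η ↦ ∑ₙ ⟪fₙ, η⟫ fₙ` of a square-summable sequence `f`; it is `0` when the
series of rank-one operators is not summable. -/
def vectorOperator (f : ℕ → H) : H →L[ℂ] H := ∑' n, rankOne ℂ (f n) (f n)

variable [CompleteSpace H]

theorem mul_starProjection_closure_span_eq_zero_iff {y : H →L[ℂ] H} :
    y * (Submodule.span ℂ (Set.range f)).topologicalClosure.starProjection = 0 ↔
      ∀ n, y (f n) = 0 := by
  set K := (Submodule.span ℂ (Set.range f)).topologicalClosure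
  constructor
  · intro h n
    have hfK : f n ∈ K := Submodule.le_topologicalClosure _ (Submodule.subset_span ⟨n, rfl⟩)
    rw [← K.starProjection_eq_self_iff.2 hfK, ← mul_apply_eq_comp, h, _root_.zero_apply]
  · intro h
    ext η
    exact ContinuousLinearMap.eqOn_closure_span (g := 0) (Set.forall_mem_range.2 h)
      (K.starProjection_apply_mem η)

theorem vectorFunctional_star_mul_self (hf : Summable fun n ↦ ‖f n‖ ^ 2) (x : H →L[ℂ] H) :
    vectorFunctional f hf (star x * x) = ((∑' n, ‖x (f n)‖ ^ 2 : ℝ) : ℂ) := by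
  rw [vectorFunctional_apply, Complex.ofReal_tsum]
  refine tsum_congr fun n ↦ ?_
  rw [mul_apply_eq_comp, ContinuousLinearMap.star_eq_adjoint,
    ContinuousLinearMap.adjoint_inner_right, inner_self_eq_norm_sq_to_K, Complex.ofReal_pow]
  rfl

theorem isNormalState_vectorFunctional (hf : HasSum (fun n ↦ ‖f n‖ ^ 2) 1) :
    IsNormalState (vectorFunctional f hf.summable) where
  nonneg x := by
    rw [vectorFunctional_star_mul_self]
    exact_mod_cast tsum_nonneg fun n ↦ by positivity
  map_one := by
    have h := vectorFunctional_star_mul_self hf.summable (1 : H →L[ℂ] H)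
    simpa [hf.tsum_eq] using h
  normal := by
    refine continuous_iff_le_induced.2 ?_
    exact (iInf_le _ f).trans ((iInf_le _ f).trans
      ((iInf_le _ hf.summable).trans (iInf_le _ hf.summable)))

theorem vectorFunctional_eq_zero_iff (hf : Summable fun n ↦ ‖f n‖ ^ 2) {e : H →L[ℂ] H}
    (he : IsStarProjection e) : vectorFunctional f hf e = 0 ↔ ∀ n, e (f n) = 0 := by
  have hstar := vectorFunctional_star_mul_self hf e
  rw [he.isSelfAdjoint.star_eq, he.isIdempotentElem.eq] at hstar
  rw [hstar, Complex.ofReal_eq_zero, ← (summable_norm_sq_apply hf e).hasSum_iff,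
    hasSum_zero_iff_of_nonneg fun n ↦ sq_nonneg _]
  simp [funext_iff]

theorem isFunctionalSupport_vectorFunctional (hf : Summable fun n ↦ ‖f n‖ ^ 2) :
    IsFunctionalSupport (vectorFunctional f hf)
      (Submodule.span ℂ (Set.range f)).topologicalClosure.starProjection := by
  set P := (Submodule.span ℂ (Set.range f)).topologicalClosure.starProjection
  have hP' : IsStarProjection (1 - P) := isStarProjection_starProjection.one_sub
  have hIic : {e : {e : H →L[ℂ] H // IsStarProjection e} | vectorFunctional f hf e = 0} =
      Set.Iic ⟨1 - P, hP'⟩ := by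
    ext ⟨e, he⟩
    rw [Set.mem_ofPred_eq, vectorFunctional_eq_zero_iff hf he,
      ← mul_starProjection_closure_span_eq_zero_iff, Set.mem_Iic, Subtype.mk_le_mk,
      he.le_iff_mul_eq_left hP', mul_sub, mul_one, sub_eq_self]
  exact ⟨⟨1 - P, hP'⟩, hIic ▸ isLUB_Iic, (sub_sub_cancel 1 P).symm⟩

theorem vectorFunctional_conjStarAlgAut (hf : Summable fun n ↦ ‖f n‖ ^ 2)
    {U : unitary (H →L[ℂ] H)} (hU : ∀ n, ∃ μ : ℂ, (U : H →L[ℂ] H) (f n) = μ • f n)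
    (x : H →L[ℂ] H) :
    vectorFunctional f hf (Unitary.conjStarAlgAut ℂ _ U x) = vectorFunctional f hf x := by
  rw [vectorFunctional_apply, vectorFunctional_apply]
  exact tsum_congr fun n ↦ inner_conjStarAlgAut_apply_self (hU n).choose_spec x

theorem hasSum_vectorOperator (hf : Summable fun n ↦ ‖f n‖ ^ 2) :
    HasSum (fun n ↦ rankOne ℂ (f n) (f n)) (vectorOperator f) := by
  refine Summable.hasSum (Summable.of_norm ?_)
  simpa only [norm_rankOne, sq] using hf

theorem isPositive_vectorOperator (f : ℕ → H) : (vectorOperator f).IsPositive := by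
  rw [← ContinuousLinearMap.nonneg_iff_isPositive]
  exact tsum_nonneg fun n ↦
    (ContinuousLinearMap.nonneg_iff_isPositive _).2 (isPositive_rankOne_self _)

theorem hasSum_inner_vectorOperator (hf : Summable fun n ↦ ‖f n‖ ^ 2) (η : H) :
    HasSum (fun n ↦ ((‖⟪f n, η⟫_ℂ‖ ^ 2 : ℝ) : ℂ)) ⟪η, vectorOperator f η⟫_ℂ := by
  have h := ((hasSum_vectorOperator hf).mapL (ContinuousLinearMap.apply ℂ H η)).mapL (innerSL ℂ η)
  exact h.congr_fun fun n ↦ (inner_rankOne_self_apply (f n) η).symm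

theorem inner_eq_zero_of_vectorOperator_apply_eq_zero (hf : Summable fun n ↦ ‖f n‖ ^ 2) {η : H}
    (h : vectorOperator f η = 0) (n : ℕ) : ⟪f n, η⟫_ℂ = 0 := by
  have hsum := hasSum_inner_vectorOperator hf η
  rw [h, inner_zero_right, ← Complex.ofReal_zero, Complex.hasSum_ofReal,
    hasSum_zero_iff_of_nonneg fun n ↦ sq_nonneg _] at hsum
  simpa using congr_fun hsum n

theorem mul_vectorOperator_eq_zero_iff (hf : Summable fun n ↦ ‖f n‖ ^ 2) {y : H →L[ℂ] H} :
    y * vectorOperator f = 0 ↔ ∀ n, y (f n) = 0 := by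
  constructor
  · intro h n
    have hstar : vectorOperator f * star y = 0 := by
      rw [← (isPositive_vectorOperator f).isSelfAdjoint.star_eq, ← star_mul, h, star_zero]
    refine ext_inner_right ℂ fun ζ ↦ ?_
    rw [inner_zero_left, ← ContinuousLinearMap.adjoint_inner_right]
    exact inner_eq_zero_of_vectorOperator_apply_eq_zero hf (DFunLike.congr_fun hstar ζ) n
  · intro h
    refine ((hasSum_vectorOperator hf).mul_left y).unique ?_
    refine hasSum_zero.congr_fun fun n ↦ ?_
    ext η
    simp [h]

theorem isOperatorSupport_vectorOperator (hf : Summable fun n ↦ ‖f n‖ ^ 2) :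
    IsOperatorSupport (vectorOperator f)
      (Submodule.span ℂ (Set.range f)).topologicalClosure.starProjection := by
  set P := (Submodule.span ℂ (Set.range f)).topologicalClosure.starProjection
  have hle {e : H →L[ℂ] H} (he : IsStarProjection e) :
      e * vectorOperator f = vectorOperator f ↔ P ≤ e := by
    rw [isStarProjection_starProjection.le_iff_mul_eq_right he, eq_comm, ← sub_eq_zero,
      ← one_sub_mul, mul_vectorOperator_eq_zero_iff hf,
      ← mul_starProjection_closure_span_eq_zero_iff, one_sub_mul, sub_eq_zero, eq_comm]
  exact ⟨⟨isStarProjection_starProjection, (hle isStarProjection_starProjection).2 le_rfl⟩,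
    fun e he ↦ (hle he.1).1 he.2⟩

end Support

section Existence

variable {H : Type*} [NormedAddCommGroup H] [InnerProductSpace ℂ H] [CompleteSpace H]
  {α : (H →L[ℂ] H) ≃⋆ₐ[ℂ] (H →L[ℂ] H)} {U : unitary (H →L[ℂ] H)} {F : ℕ → Finset ℤ}

theorem eq_conjStarAlgAut (hU : ∀ x, α x = U * x * star (U : H →L[ℂ] H)) :
    α = Unitary.conjStarAlgAut ℂ _ U :=
  StarAlgEquiv.ext fun x ↦ by rw [hU, Unitary.conjStarAlgAut_apply]

theorem isWeaklyWandering_vectorOperator {f : ℕ → H} (hF : IsFolnerSeq F)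
    (hf : Summable fun n ↦ ‖f n‖ ^ 2) (hmem : ∀ n, f n ∈ (compactPart U)ᗮ) :
    IsWeaklyWandering (Unitary.conjStarAlgAut ℂ _ U) F (vectorOperator f) := by
  refine ⟨isPositive_vectorOperator f, tendsto_zero_iff_norm_tendsto_zero.1 ?_⟩
  refine tendsto_average_zero_of_hasSum ?_ (hasSum_vectorOperator hf) fun n ↦
    tendsto_average_rankOne_zero hF (hmem n)
  simpa only [InnerProductSpace.norm_rankOne, sq] using hf

theorem compactPart_le_of_forall_eigenvector_mem {K : Submodule ℂ H} (hK : IsClosed (K : Set H))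
    (h : ∀ (μ : ℂ) (v : H), (U : H →L[ℂ] H) v = μ • v → v ∈ K) : compactPart U ≤ K :=
  Submodule.topologicalClosure_minimal _
    (iSup_le fun μ v hv ↦ h μ v (Module.End.mem_eigenspace_iff.1 hv)) hK

theorem mem_compactPart_of_apply_eq_smul {μ : ℂ} {v : H} (hv : (U : H →L[ℂ] H) v = μ • v) :
    v ∈ compactPart U :=
  Submodule.le_topologicalClosure _ <|
    Submodule.mem_iSup_of_mem μ (Module.End.mem_eigenspace_iff.2 hv)

theorem exists_eigenvector_ne_zero (hne : compactProj U ≠ 0) :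
    ∃ v ≠ 0, ∃ μ : ℂ, (U : H →L[ℂ] H) v = μ • v := by
  by_contra! hzero
  refine hne (ContinuousLinearMap.ext fun η ↦ ?_)
  have hbot : compactPart U ≤ ⊥ :=
    compactPart_le_of_forall_eigenvector_mem isClosed_singleton fun μ v hv ↦
      by_contra fun hv0 ↦ hzero v hv0 μ hv
  exact hbot ((compactPart U).starProjection_apply_mem η)

variable [TopologicalSpace.SeparableSpace H]

theorem exists_isNormalState (hU : ∀ x, α x = U * x * star (U : H →L[ℂ] H))
    (hne : compactProj U ≠ 0) :
    ∃ φ : (H →L[ℂ] H) →ₗ[ℂ] ℂ, IsNormalState φ ∧ (∀ x, φ (α x) = φ x) ∧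
      IsFunctionalSupport φ (compactProj U) := by
  rw [eq_conjStarAlgAut hU]
  obtain ⟨v, hv0, hv⟩ := exists_eigenvector_ne_zero hne
  obtain ⟨f, hfE, hf, hE⟩ := exists_hasSum_norm_sq_one_subset_closure_span (𝕜 := ℂ)
    (TopologicalSpace.IsSeparable.of_separableSpace
      {v : H | ∃ μ : ℂ, (U : H →L[ℂ] H) v = μ • v}) hv hv0
    (by
      rintro c w ⟨μ, hw⟩
      exact ⟨μ, by rw [map_smul, hw, smul_comm]⟩)
  have hspan : (Submodule.span ℂ (Set.range f)).topologicalClosure = compactPart U := by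
    refine le_antisymm (Submodule.topologicalClosure_minimal _ (Submodule.span_le.2 ?_)
      (Submodule.isClosed_topologicalClosure _)) ?_
    · exact Set.range_subset_iff.2 fun n ↦ mem_compactPart_of_apply_eq_smul (hfE n).choose_spec
    · exact compactPart_le_of_forall_eigenvector_mem (Submodule.isClosed_topologicalClosure _)
        fun μ w hw ↦ hE ⟨μ, hw⟩
  refine ⟨vectorFunctional f hf.summable, isNormalState_vectorFunctional hf,
    vectorFunctional_conjStarAlgAut hf.summable hfE, ?_⟩
  simpa only [compactProj, hspan] using isFunctionalSupport_vectorFunctional hf.summable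

theorem exists_isWeaklyWandering (hU : ∀ x, α x = U * x * star (U : H →L[ℂ] H))
    (hF : IsFolnerSeq F) :
    ∃ x : H →L[ℂ] H, IsWeaklyWandering α F x ∧ IsOperatorSupport x (weaklyMixingProj U F) := by
  rw [eq_conjStarAlgAut hU]
  obtain ⟨f, hfE, hf, hE⟩ := exists_summable_norm_sq_subset_closure_span (𝕜 := ℂ)
    (TopologicalSpace.IsSeparable.of_separableSpace (weaklyMixingPart U F : Set H))
    ⟨0, zero_mem _⟩ fun c v hv ↦ Submodule.smul_mem _ c hv
  have hspan : (Submodule.span ℂ (Set.range f)).topologicalClosure = weaklyMixingPart U F :=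
    le_antisymm (Submodule.topologicalClosure_minimal _
      (Submodule.span_le.2 (Set.range_subset_iff.2 hfE)) (isClosed_weaklyMixingPart U F)) hE
  refine ⟨vectorOperator f, isWeaklyWandering_vectorOperator hF hf fun n ↦
    weaklyMixingPart_le_orthogonal_compactPart hF U (hfE n), ?_⟩
  simpa only [weaklyMixingProj, hspan] using isOperatorSupport_vectorOperator hf

end Existence

end NeveuBH

end

theorem mainTheorem10 {H : Type*} [NormedAddCommGroup H] [InnerProductSpace ℂ H]
    [CompleteSpace H] [TopologicalSpace.SeparableSpace H]
    (α : (H →L[ℂ] H) ≃⋆ₐ[ℂ] (H →L[ℂ] H)) :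
    (∃ U : unitary (H →L[ℂ] H), ∀ x, α x = U * x * star (U : H →L[ℂ] H)) ∧
    ∀ U : unitary (H →L[ℂ] H), (∀ x, α x = U * x * star (U : H →L[ℂ] H)) →
    ∀ F : ℕ → Finset ℤ, NeveuBH.IsFolnerSeq F →
      NeveuBH.compactProj U + NeveuBH.weaklyMixingProj U F = 1 ∧
      (NeveuBH.compactProj U ≠ 0 →
        ∃ φ : (H →L[ℂ] H) →ₗ[ℂ] ℂ, NeveuBH.IsNormalState φ ∧ (∀ x, φ (α x) = φ x) ∧
          NeveuBH.IsFunctionalSupport φ (NeveuBH.compactProj U)) ∧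
      ∃ x : H →L[ℂ] H, NeveuBH.IsWeaklyWandering α F x ∧
        NeveuBH.IsOperatorSupport x (NeveuBH.weaklyMixingProj U F) :=
  ⟨NeveuBH.exists_unitary_of_starAlgEquiv α, fun U hU _ hF ↦
    ⟨NeveuBH.compactProj_add_weaklyMixingProj hF U, NeveuBH.exists_isNormalState hU,
      NeveuBH.exists_isWeaklyWandering hU hF⟩⟩
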